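/- A pushdown automaton (PDA) $P=(Q,\Sigma,\Gamma,\delta,q_0,Z_0,F)$ has finite $Q,\Sigma,\Gamma$ and $\delta:Q\times(\Sigma\cup\{\varepsilon\})\times\Gamma\to 2^{Q\times\Gamma^{\le 2}}$. It starts in the configuration $(q_0,Z_0)$ and accepts by final state; $L(P)$ is its language. For a computable $f:\mathbb N\to\mathbb N$, the $f(n)$-parameterised explorability game on $P$ is played as follows. Spoiler announces $n\in\mathbb N$, and $f(n)$ tokens are placed on the initial configuration. In each round (at most $n$ rounds) Spoiler chooses a letter $x\in\Sigma$, and Determiner moves every token along a path of $P$ of the form $\xrightarrow{\varepsilon}\cdots\xrightarrow{\varepsilon}\xrightarrow{x}$ (she loses if she cannot). Determiner wins if, for every prefix $w$ (possibly empty or the whole word) of the word played with $w\in L(P)$, some token is in a state of $F$ after the rounds of $w$. $P$ is $f(n)$-explorable if Determiner has a winning strategy. For a class $C$ of functions, $\mathsf{Expl}_C\text{-}\mathsf{CFL}$ is the class of languages $L(P)$ of PDAs $P$ that are $f(n)$-explorable for some computable $f\in C$. Let $$L_{block}=\{a^{\ell_1}\#a^{\ell_2}\#\cdots a^{\ell_m}\#\,b^{\ell}\;:\;m\ge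 1,\ \ell_1,\dots,\ell_m\ge 0,\ \ell\in\{\ell_1,\dots,\ell_m\}\}\subseteq\{a,b,\#\}^*.$$ **Lemma.** $\mathsf{Expl}_{O(1)}\text{-}\mathsf{CFL}\subsetneq\mathsf{Expl}_{O(n)}\text{-}\mathsf{CFL}$: the inclusion holds over every finite alphabet, and it is strict over $\{a,b,\#\}$, since $L_{block}\in\mathsf{Expl}_{O(n)}\text{-}\mathsf{CFL}$ and $L_{block}\notin\mathsf{Expl}_{O(1)}\text{-}\mathsf{CFL}$. Moreover, one token per $a$-block suffices: there is a PDA $P$ with $L(P)=L_{block}$ such that, for every $n$, Determiner has a winning strategy with $n$ tokens in the game in which Spoiler announces $n$, and under this strategy, for every word $w$ of length at most $n$ and every $i\in\{1,\dots,n\}$, token $i$ is in an accepting state after $w$ if and only if $w=a^{\ell_1}\#\cdots a^{\ell_m}\#\,b^{\ell}$ for some $m\ge i$ with $\ell=\ell_i$. -/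

import Mathlib

/-- A pushdown automaton with states `Q`, input alphabet `A` and stack alphabet `G`
(finiteness of these types is imposed where automata are quantified over).
`(q', γ) ∈ δ q o X` means: in state `q` with `X` on top of the stack, the automaton may read `o`
(`none` is the empty word), move to `q'` and replace `X` by the word `γ` of length at most two. -/
structure PDA (Q A G : Type) where
  δ : Q → Option A → G → Set (Q × List G)
  length_le_two : ∀ q o X q' γ, (q', γ) ∈ δ q o X → γ.length ≤ 2
  q₀ : Q
  Z₀ : G
  F : Set Q

namespace PDA

variable {Q A G : Type}

/-- A configuration: a state and a stack content, the head of the list being the top. -/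
abbrev Conf (Q G : Type) : Type := Q × List G

/-- The initial configuration. -/
def init (P : PDA Q A G) : Conf Q G := (P.q₀, [P.Z₀])

/-- A single transition, labelled by a letter or by `none` for the empty word. No transition
is possible from an empty stack. -/
inductive Step (P : PDA Q A G) : Conf Q G → Option A → Conf Q G → Prop
  | mk {q q' : Q} {o : Option A} {X : G} {γ β : List G} (h : (q', γ) ∈ P.δ q o X) :
      Step P (q, X :: β) o (q', γ ++ β)

/-- `P.Run c w d`: some run leads from `c` to `d` reading `w`; transitions reading the empty word
may occur anywhere. -/
inductive Run (P : PDA Q A G) : Conf Q G → List A → Conf Q G → Prop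
  | refl (c : Conf Q G) : Run P c [] c
  | eps {c c' d : Conf Q G} {w : List A} (h : P.Step c none c') (t : Run P c' w d) : Run P c w d
  | read {c c' d : Conf Q G} {a : A} {w : List A} (h : P.Step c (some a) c') (t : Run P c' w d) :
      Run P c (a :: w) d

/-- The language of `P`, acceptance being by final state. -/
def language (P : PDA Q A G) : Language A :=
  {w | ∃ d : Conf Q G, P.Run P.init w d ∧ d.1 ∈ P.F}

/-- A legal move of one token in a round with letter `a`: finitely many transitions reading the
empty word, followed by one transition reading `a`. -/
def TokenMove (P : PDA Q A G) (c : Conf Q G) (a : A) (d : Conf Q G) : Prop :=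
  ∃ c' : Conf Q G, Relation.ReflTransGen (fun x y => P.Step x none y) c c' ∧ P.Step c' (some a) d

/-- A strategy of Determiner with `k` tokens: the positions of the tokens after Spoiler has played
a given word. (Determiner's own earlier choices are determined by the strategy and the
prefixes of that word, so they need not be arguments.) -/
abbrev Strategy (Q A G : Type) (k : ℕ) : Type := List A → Fin k → Conf Q G

/-- The strategy `σ` is legal, and winning for Determiner, in the game with `k` tokens in which
Spoiler plays at most `n` letters. -/
structure IsWinning (P : PDA Q A G) (n : ℕ) {k : ℕ} (σ : Strategy Q A G k) : Prop where
  start : ∀ l : Fin k, σ [] l = P.init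
  move : ∀ (w : List A) (a : A), w.length < n → ∀ l : Fin k, P.TokenMove (σ w l) a (σ (w ++ [a]) l)
  win : ∀ w : List A, w.length ≤ n → w ∈ P.language → ∃ l : Fin k, (σ w l).1 ∈ P.F

/-- `P` is `f(n)`-explorable: whatever bound `n` Spoiler announces, Determiner has a winning
strategy with `f n` tokens. -/
def IsExplorable (P : PDA Q A G) (f : ℕ → ℕ) : Prop :=
  ∀ n : ℕ, ∃ σ : Strategy Q A G (f n), P.IsWinning n σ

end PDA

/-- The class of languages over `A` recognised by an `f(n)`-explorable pushdown automaton for some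
computable function `f` in `C`. -/
def ExplCFL (A : Type) (C : Set (ℕ → ℕ)) : Set (Language A) :=
  {L | ∃ f : ℕ → ℕ, Computable f ∧ f ∈ C ∧
    ∃ (Q G : Type) (_ : Finite Q) (_ : Finite G) (P : PDA Q A G),
      P.language = L ∧ P.IsExplorable f}

/-- The class `O(g)` of functions on the natural numbers. -/
def BigO (g : ℕ → ℕ) : Set (ℕ → ℕ) :=
  {f | (fun n => (f n : ℝ)) =O[Filter.atTop] (fun n => (g n : ℝ))}

/-- The three-letter alphabet `{a, b, #}`. -/
inductive Letter : Type
  | a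
  | b
  | sharp
  deriving DecidableEq

instance : Fintype Letter :=
  ⟨{Letter.a, Letter.b, Letter.sharp}, fun x => by cases x <;> simp⟩

/-- `a^{ℓ₁} # a^{ℓ₂} # ⋯ a^{ℓₘ} # b^n`, for the list `ls = [ℓ₁, …, ℓₘ]`. -/
def blockWord (ls : List ℕ) (n : ℕ) : List Letter :=
  ls.flatMap (fun l => List.replicate l Letter.a ++ [Letter.sharp]) ++ List.replicate n Letter.b

/-- The language `(a* #)* b^n` where `n` is the length of some `a`-block. -/
def Lblock : Language Letter :=
  {w | ∃ (ls : List ℕ) (n : ℕ), n ∈ ls ∧ w = blockWord ls n}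

/-! A pushdown automaton for `Lblock` only has to guess the block whose length is the number of
`b`s: it pushes that block and pops it against the `b`s. A word of length at most `n` has at most
`n` blocks, so `n` tokens, each devoted to one block, cover all guesses (`blockPDA_isWinning`).

Against boundedly many tokens, Spoiler plays `N` long blocks of distinct lengths, with `N` above the
number of tokens, and then `b`s. Determiner needs an accepting token at `N` different numbers of
`b`s, so one token accepts twice: a single run accepts both `v` and `v b^t`. This is excluded by
`PDA.not_exists_run_of_language_eq_Lblock`. A new letter marks the moment of the first acceptance,
so that the word becomes one of the automaton `PDA.twoPhase`, where a word with one mark always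
encodes two acceptances along one run of `P`. An Ogden-type argument (`PDA.Pops.hasPump`) then pumps
two factors that contain no separator and lengthen the block matched first. They lie in at most two
segments between separators. For the first acceptance to survive, these must be that block and the
`b`s before the mark; but then no other block grows, and the total number of `b`s matches no block.
-/

section BlockWords

/-! ### Decomposition of block words -/

theorem blockWord_cons (l : ℕ) (ls : List ℕ) (m : ℕ) :
    blockWord (l :: ls) m = List.replicate l Letter.a ++ Letter.sharp :: blockWord ls m := by
  simp [blockWord]

theorem blockWord_zero_cons (ls : List ℕ) (m : ℕ) :
    blockWord (0 :: ls) m = Letter.sharp :: blockWord ls m := by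
  simp [blockWord_cons]

theorem blockWord_succ_cons (l : ℕ) (ls : List ℕ) (m : ℕ) :
    blockWord ((l + 1) :: ls) m = Letter.a :: blockWord (l :: ls) m := by
  simp [blockWord_cons, List.replicate_succ]

theorem blockWord_nil (m : ℕ) : blockWord [] m = List.replicate m Letter.b := by
  simp [blockWord]

theorem nil_eq_blockWord_iff (ls : List ℕ) (m : ℕ) :
    [] = blockWord ls m ↔ ls = [] ∧ m = 0 := by
  rcases ls with _ | ⟨l, ls⟩
  · rw [blockWord_nil]; cases m <;> simp [List.replicate_succ]
  · simp [blockWord_cons]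

theorem a_cons_eq_blockWord_iff (w : List Letter) (ls : List ℕ) (m : ℕ) :
    Letter.a :: w = blockWord ls m ↔
      ∃ l ls', ls = (l + 1) :: ls' ∧ w = blockWord (l :: ls') m := by
  rcases ls with _ | ⟨_ | l, ls⟩
  · rw [blockWord_nil]; cases m <;> simp [List.replicate_succ]
  · simp [blockWord_zero_cons]
  · rw [blockWord_succ_cons]
    constructor
    · intro h
      exact ⟨l, ls, rfl, (List.cons.inj h).2⟩
    · rintro ⟨l', ls', h, rfl⟩
      obtain ⟨h1, rfl⟩ := List.cons.inj h
      obtain rfl : l = l' := by omega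
      rfl

theorem sharp_cons_eq_blockWord_iff (w : List Letter) (ls : List ℕ) (m : ℕ) :
    Letter.sharp :: w = blockWord ls m ↔ ∃ ls', ls = 0 :: ls' ∧ w = blockWord ls' m := by
  rcases ls with _ | ⟨_ | l, ls⟩
  · rw [blockWord_nil]; cases m <;> simp [List.replicate_succ]
  · simp [blockWord_zero_cons]
  · simp [blockWord_succ_cons]

theorem b_cons_eq_blockWord_iff (w : List Letter) (ls : List ℕ) (m : ℕ) :
    Letter.b :: w = blockWord ls m ↔
      ls = [] ∧ ∃ m', m = m' + 1 ∧ w = List.replicate m' Letter.b := by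
  rcases ls with _ | ⟨_ | l, ls⟩
  · rw [blockWord_nil]; cases m <;> simp [List.replicate_succ]
  · simp [blockWord_zero_cons]
  · simp [blockWord_succ_cons]

theorem length_le_length_blockWord (ls : List ℕ) (m : ℕ) :
    ls.length ≤ (blockWord ls m).length := by
  induction ls with
  | nil => simp
  | cons l ls ih => simp [blockWord_cons]; omega

end BlockWords

/-! ### The automaton that guesses a block -/

/-- States of the automaton for `Lblock`: `idle` is the state between blocks while no block has
been chosen, `skip` the state inside a block that is not chosen, `count` the state inside the
chosen block, `wait` and `waitIn` the states between and inside later blocks, and `pop` the state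
reached by reading `b`. The flag of `wait` and `pop` tells that the counter is zero. -/
inductive BlockState : Type
  | idle
  | skip
  | count
  | wait (z : Bool)
  | waitIn
  | pop (z : Bool)
  | dead

instance : Finite BlockState :=
  Finite.of_injective (fun q : BlockState => match q with
    | .idle => (0 : Fin 9) | .skip => 1 | .count => 2 | .wait false => 3 | .wait true => 4
    | .waitIn => 5 | .pop false => 6 | .pop true => 7 | .dead => 8)
    (by rintro (_ | _ | _ | (_ | _) | _ | (_ | _) | _) (_ | _ | _ | (_ | _) | _ | (_ | _) | _) <;> simp)

/-- Stack symbols: the bottom of the stack, the first counter symbol and the further ones. -/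
inductive BlockSym : Type
  | bot
  | first
  | more

instance : Finite BlockSym :=
  Finite.of_injective (fun X : BlockSym => match X with | .bot => (0 : Fin 3) | .first => 1 | .more => 2)
    (by rintro (_ | _) (_ | _) <;> simp)

namespace BlockSym

/-- The counter symbol that may lie on top of a given symbol. -/
def succ : BlockSym → BlockSym
  | bot => first
  | first => more
  | more => more

/-- Whether a symbol is the bottom symbol. -/
def isBot : BlockSym → Bool
  | bot => true
  | first => false
  | more => false

end BlockSym

open BlockState BlockSym in
/-- The move of the automaton for `Lblock`; the flag says whether to choose the block that is
about to begin. -/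
def blockNext (ch : Bool) : BlockState → Letter → BlockSym → BlockState × List BlockSym
  | idle, .a, X => if ch then (count, [X.succ, X]) else (skip, [X])
  | idle, .sharp, X => if ch then (wait true, [X]) else (idle, [X])
  | skip, .a, X => (skip, [X])
  | skip, .sharp, X => (idle, [X])
  | count, .a, X => (count, [X.succ, X])
  | count, .sharp, X => (wait X.isBot, [X])
  | wait _, .a, X => (waitIn, [X])
  | wait z, .sharp, X => (wait z, [X])
  | wait _, .b, first => (pop true, [])
  | wait _, .b, more => (pop false, [])
  | waitIn, .a, X => (waitIn, [X])
  | waitIn, .sharp, X => (wait X.isBot, [X])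
  | pop _, .b, first => (pop true, [])
  | pop _, .b, more => (pop false, [])
  | _, _, X => (dead, [X])

/-- The pushdown automaton for `Lblock`. -/
def blockPDA : PDA BlockState Letter BlockSym where
  δ q o X := {y | ∃ x ch, o = some x ∧ y = blockNext ch q x X}
  length_le_two := by
    rintro q o X q' γ ⟨x, ch, -, h⟩
    have : γ = (blockNext ch q x X).2 := by rw [← h]
    subst this
    cases q <;> cases x <;> cases X <;> cases ch <;> simp [blockNext]
  q₀ := .idle
  Z₀ := .bot
  F := {.wait true, .pop true}

/-! ### Trajectories, the language of the automaton and the winning strategy -/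

/-- The stack of `blockPDA` with counter value `r`. -/
def counterStack : ℕ → List BlockSym
  | 0 => [.bot]
  | 1 => [.first, .bot]
  | r + 2 => .more :: counterStack (r + 1)

/-- The configuration of `blockPDA` after a letter. -/
def blockAdvance (ch : Bool) (x : Letter) : PDA.Conf BlockState BlockSym →
    PDA.Conf BlockState BlockSym
  | (q, []) => (q, [])
  | (q, X :: β) => ((blockNext ch q x X).1, (blockNext ch q x X).2 ++ β)

/-- The configuration of `blockPDA` after a word, if the first `k` blocks are skipped and the next
one is chosen. -/
def blockTraj : ℕ → List Letter → PDA.Conf BlockState BlockSym → PDA.Conf BlockState BlockSym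
  | _, [], c => c
  | k, x :: w, c =>
    blockTraj (k - if x = .sharp then 1 else 0) w (blockAdvance (decide (k = 0)) x c)

/-- Trajectories recurse on the front of the word, whereas the game extends it at the end. Truncated
subtraction recovers the number of blocks still to be skipped. -/
theorem blockTraj_concat (k : ℕ) (w : List Letter) (x : Letter)
    (c : PDA.Conf BlockState BlockSym) :
    blockTraj k (w ++ [x]) c =
      blockAdvance (decide (k - w.count .sharp = 0)) x (blockTraj k w c) := by
  induction w generalizing k c with
  | nil => simp [blockTraj]
  | cons y w ih =>
    simp only [List.cons_append, blockTraj, ih]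
    congr 3
    rw [List.count_cons, Nat.sub_sub, Nat.add_comm]
    simp

theorem blockAdvance_counterStack (ch : Bool) (x : Letter) (q : BlockState) (r : ℕ) :
    ∃ q' r', blockAdvance ch x (q, counterStack r) = (q', counterStack r') := by
  rcases r with _ | _ | r
  · cases q <;> cases x <;> cases ch <;>
      first
      | exact ⟨_, 0, rfl⟩
      | exact ⟨_, 1, rfl⟩
  · cases q <;> cases x <;> cases ch <;>
      first
      | exact ⟨_, 0, rfl⟩
      | exact ⟨_, 1, rfl⟩
      | exact ⟨_, 2, rfl⟩
  · cases q <;> cases x <;> cases ch <;>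
      first
      | exact ⟨_, r + 1, rfl⟩
      | exact ⟨_, r + 2, rfl⟩
      | exact ⟨_, r + 3, rfl⟩

theorem blockTraj_counterStack (k : ℕ) (w : List Letter) (q : BlockState) (r : ℕ) :
    ∃ q' r', blockTraj k w (q, counterStack r) = (q', counterStack r') := by
  induction w generalizing k q r with
  | nil => exact ⟨q, r, rfl⟩
  | cons x w ih =>
    obtain ⟨q', r', h⟩ := blockAdvance_counterStack (decide (k = 0)) x q r
    simp only [blockTraj, h]
    exact ih _ _ _

theorem counterStack_ne_nil (r : ℕ) : counterStack r ≠ [] := by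
  rcases r with _ | _ | r <;> simp [counterStack]

theorem blockPDA_step_iff (c d : PDA.Conf BlockState BlockSym) (o : Option Letter) :
    blockPDA.Step c o d ↔ c.2 ≠ [] ∧ ∃ x ch, o = some x ∧ d = blockAdvance ch x c := by
  constructor
  · rintro ⟨x, ch, ho, h⟩
    refine ⟨by simp, x, ch, ho, ?_⟩
    simp [blockAdvance, ← h]
  · obtain ⟨q, _ | ⟨X, β⟩⟩ := c
    · simp
    · rintro ⟨-, x, ch, rfl, rfl⟩
      exact PDA.Step.mk ⟨x, ch, rfl, rfl⟩

theorem blockTraj_dead (k : ℕ) (w : List Letter) (β : List BlockSym) :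
    (blockTraj k w (.dead, β)).1 = .dead := by
  induction w generalizing k β with
  | nil => rfl
  | cons x w ih =>
    rcases β with _ | ⟨X, β⟩
    · exact ih _ _
    · cases x <;> exact ih _ _

theorem dead_notMem : BlockState.dead ∉ blockPDA.F := by
  simp [blockPDA]

-- Simultaneous induction on `w`, with one clause per state other than `dead`. In `skip` the
-- parameter is `k + 1` because the separator ending the skipped block is still to come; in `count`,
-- the chosen block has contributed `r` so far and `l` letters of it remain.
open BlockState in
theorem blockTraj_accept_iff (w : List Letter) :
    (∀ k, (blockTraj k w (idle, [.bot])).1 ∈ blockPDA.F ↔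
      ∃ ls m, w = blockWord ls m ∧ ls[k]? = some m) ∧
    (∀ k, (blockTraj (k + 1) w (skip, [.bot])).1 ∈ blockPDA.F ↔
      ∃ l ls m, w = blockWord (l :: ls) m ∧ ls[k]? = some m) ∧
    (∀ k r, (blockTraj k w (count, counterStack r)).1 ∈ blockPDA.F ↔
      ∃ l ls, w = blockWord (l :: ls) (r + l)) ∧
    (∀ k r, (blockTraj k w (wait (decide (r = 0)), counterStack r)).1 ∈ blockPDA.F ↔
      ∃ ls, w = blockWord ls r) ∧
    (∀ k r, (blockTraj k w (waitIn, counterStack r)).1 ∈ blockPDA.F ↔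
      ∃ l ls, w = blockWord (l :: ls) r) ∧
    (∀ k r, (blockTraj k w (pop (decide (r = 0)), counterStack r)).1 ∈ blockPDA.F ↔
      w = List.replicate r .b) := by
  induction w with
  | nil =>
    have h1 : ∀ (k : ℕ) (ls : List ℕ) (m : ℕ), ([] = blockWord ls m ∧ ls[k]? = some m) ↔ False := by
      intro k ls m
      rw [nil_eq_blockWord_iff]
      simp only [iff_false, not_and, and_imp]
      rintro rfl -
      simp
    have h2 : ∀ l (ls : List ℕ) m, ([] = blockWord (l :: ls) m) ↔ False := by
      intro l ls m
      rw [nil_eq_blockWord_iff]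
      simp
    have h3 : ∀ r, [] = List.replicate r Letter.b ↔ r = 0 := by
      rintro (_ | r) <;> simp [List.replicate_succ]
    have h4 : ∀ r, (∃ ls, [] = blockWord ls r) ↔ r = 0 := by
      intro r
      simp only [nil_eq_blockWord_iff]
      simp
    simp only [h1, h2, h3, h4, blockTraj]
    simp [blockPDA]
  | cons x w ih =>
    obtain ⟨hidle, hskip, hcount, hwait, hwaitIn, hpop⟩ := ih
    have hd : ∀ k β, (blockTraj k w (dead, β)).1 ∈ blockPDA.F ↔ False := fun k β => by
      simp [blockTraj_dead, dead_notMem]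
    have hisBot : ∀ r, ∃ X β, counterStack r = X :: β ∧ X.isBot = decide (r = 0) ∧
        counterStack (r + 1) = X.succ :: X :: β := by
      rintro (_ | _ | r)
      · exact ⟨_, _, rfl, rfl, rfl⟩
      · exact ⟨_, _, rfl, rfl, rfl⟩
      · exact ⟨_, _, rfl, by simp [BlockSym.isBot], rfl⟩
    have hcountA : ∀ ch r, blockAdvance ch .a (count, counterStack r) =
        (count, counterStack (r + 1)) := by
      intro ch r
      obtain ⟨X, β, h, -, h'⟩ := hisBot r
      rw [h', h]; rfl
    have hcountS : ∀ ch r, blockAdvance ch .sharp (count, counterStack r) =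
        (wait (decide (r = 0)), counterStack r) := by
      intro ch r
      obtain ⟨X, β, h, h', -⟩ := hisBot r
      rw [← h', h]; rfl
    have hcountB : ∀ ch r, blockAdvance ch .b (count, counterStack r) =
        (dead, counterStack r) := by
      intro ch r
      obtain ⟨X, β, h, h', -⟩ := hisBot r
      rw [h]; rfl
    have hwaitA : ∀ ch z r, blockAdvance ch .a (wait z, counterStack r) =
        (waitIn, counterStack r) := by
      intro ch z r
      obtain ⟨X, β, h, h', -⟩ := hisBot r
      rw [h]; rfl
    have hwaitS : ∀ ch z r, blockAdvance ch .sharp (wait z, counterStack r) =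
        (wait z, counterStack r) := by
      intro ch z r
      obtain ⟨X, β, h, h', -⟩ := hisBot r
      rw [h]; rfl
    have hwaitB : ∀ ch z r, blockAdvance ch .b (wait z, counterStack (r + 1)) =
        (pop (decide (r = 0)), counterStack r) := by
      rintro ch z (_ | r)
      · rfl
      · simp [blockAdvance, counterStack, blockNext]
    have hwaitInA : ∀ ch r, blockAdvance ch .a (waitIn, counterStack r) =
        (waitIn, counterStack r) := by
      intro ch r
      obtain ⟨X, β, h, h', -⟩ := hisBot r
      rw [h]; rfl
    have hwaitInS : ∀ ch r, blockAdvance ch .sharp (waitIn, counterStack r) =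
        (wait (decide (r = 0)), counterStack r) := by
      intro ch r
      obtain ⟨X, β, h, h', -⟩ := hisBot r
      rw [← h', h]; rfl
    have hwaitInB : ∀ ch r, blockAdvance ch .b (waitIn, counterStack r) =
        (dead, counterStack r) := by
      intro ch r
      obtain ⟨X, β, h, h', -⟩ := hisBot r
      rw [h]; rfl
    have hpopA : ∀ ch z r, blockAdvance ch .a (pop z, counterStack r) =
        (dead, counterStack r) := by
      intro ch z r
      obtain ⟨X, β, h, h', -⟩ := hisBot r
      rw [h]; rfl
    have hpopS : ∀ ch z r, blockAdvance ch .sharp (pop z, counterStack r) =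
        (dead, counterStack r) := by
      intro ch z r
      obtain ⟨X, β, h, h', -⟩ := hisBot r
      rw [h]; rfl
    have hpopB : ∀ ch z r, blockAdvance ch .b (pop z, counterStack (r + 1)) =
        (pop (decide (r = 0)), counterStack r) := by
      rintro ch z (_ | r)
      · rfl
      · simp [blockAdvance, counterStack, blockNext]
    refine ⟨fun k => ?_, fun k => ?_, fun k r => ?_, fun k r => ?_, fun k r => ?_, fun k r => ?_⟩
    · rcases x with _ | _ | _
      · rcases k with _ | k
        · refine (hcount 0 1).trans ?_
          simp only [a_cons_eq_blockWord_iff]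
          constructor
          · rintro ⟨l, ls, rfl⟩
            exact ⟨_, _, ⟨l, ls, rfl, rfl⟩, by simp [Nat.add_comm]⟩
          · rintro ⟨_, m, ⟨l, ls, rfl, rfl⟩, h⟩
            obtain rfl : l + 1 = m := by simpa using h
            exact ⟨l, ls, by rw [Nat.add_comm]⟩
        · refine (hskip k).trans ?_
          simp only [a_cons_eq_blockWord_iff]
          constructor
          · rintro ⟨l, ls, m, rfl, h⟩
            exact ⟨_, m, ⟨l, ls, rfl, rfl⟩, by simpa using h⟩
          · rintro ⟨_, m, ⟨l, ls, rfl, rfl⟩, h⟩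
            exact ⟨l, ls, m, rfl, by simpa using h⟩
      · have h0 : blockTraj k (.b :: w) (idle, [.bot]) =
            blockTraj k w (dead, [.bot]) := rfl
        rw [h0, hd, false_iff]
        rintro ⟨ls, m, h, h'⟩
        rw [b_cons_eq_blockWord_iff] at h
        simp [h.1] at h'
      · rcases k with _ | k
        · refine (hwait 0 0).trans ?_
          simp only [sharp_cons_eq_blockWord_iff]
          constructor
          · rintro ⟨ls, rfl⟩
            exact ⟨_, 0, ⟨ls, rfl, rfl⟩, by simp⟩
          · rintro ⟨_, m, ⟨ls, rfl, rfl⟩, h⟩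
            obtain rfl : 0 = m := by simpa using h
            exact ⟨ls, rfl⟩
        · refine (hidle k).trans ?_
          simp only [sharp_cons_eq_blockWord_iff]
          constructor
          · rintro ⟨ls, m, rfl, h⟩
            exact ⟨_, m, ⟨ls, rfl, rfl⟩, by simpa using h⟩
          · rintro ⟨_, m, ⟨ls, rfl, rfl⟩, h⟩
            exact ⟨ls, m, rfl, by simpa using h⟩
    · rcases x with _ | _ | _
      · refine (hskip k).trans ?_
        simp only [a_cons_eq_blockWord_iff]
        constructor
        · rintro ⟨l, ls, m, rfl, h⟩
          exact ⟨_, _, m, ⟨l, ls, rfl, rfl⟩, h⟩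
        · rintro ⟨_, _, m, ⟨l, ls, h, rfl⟩, h'⟩
          obtain ⟨rfl, rfl⟩ := List.cons.inj h
          exact ⟨l, _, m, rfl, h'⟩
      · refine (hd (k + 1) [.bot]).trans ?_
        simp [b_cons_eq_blockWord_iff]
      · refine (hidle k).trans ?_
        simp only [sharp_cons_eq_blockWord_iff]
        constructor
        · rintro ⟨ls, m, rfl, h⟩
          exact ⟨0, ls, m, ⟨_, rfl, rfl⟩, h⟩
        · rintro ⟨_, _, m, ⟨ls, h, rfl⟩, h'⟩
          obtain ⟨rfl, rfl⟩ := List.cons.inj h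
          exact ⟨_, m, rfl, h'⟩
    · rcases x with _ | _ | _
      · rw [blockTraj, hcountA, hcount]
        simp only [a_cons_eq_blockWord_iff]
        constructor
        · rintro ⟨l, ls, rfl⟩
          exact ⟨l + 1, ls, l, ls, rfl, by congr 1; omega⟩
        · rintro ⟨_, _, l, ls, h, rfl⟩
          obtain ⟨rfl, rfl⟩ := List.cons.inj h
          exact ⟨l, _, by congr 1; omega⟩
      · rw [blockTraj, hcountB, hd]
        simp [b_cons_eq_blockWord_iff]
      · rw [blockTraj, hcountS, hwait]
        simp only [sharp_cons_eq_blockWord_iff]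
        constructor
        · rintro ⟨ls, rfl⟩
          exact ⟨0, ls, ls, rfl, rfl⟩
        · rintro ⟨_, _, ls, h, rfl⟩
          obtain ⟨rfl, rfl⟩ := List.cons.inj h
          exact ⟨_, rfl⟩
    · rcases x with _ | _ | _
      · rw [blockTraj, hwaitA, hwaitIn]
        simp only [a_cons_eq_blockWord_iff]
        constructor
        · rintro ⟨l, ls, rfl⟩
          exact ⟨_, l, ls, rfl, rfl⟩
        · rintro ⟨_, l, ls, rfl, rfl⟩
          exact ⟨l, _, rfl⟩
      · rcases r with _ | r
        · refine (hd k [.bot]).trans ?_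
          simp [b_cons_eq_blockWord_iff]
        · rw [blockTraj, hwaitB, hpop]
          simp [b_cons_eq_blockWord_iff]
      · rw [blockTraj, hwaitS, hwait]
        simp only [sharp_cons_eq_blockWord_iff]
        constructor
        · rintro ⟨ls, rfl⟩
          exact ⟨_, ls, rfl, rfl⟩
        · rintro ⟨_, ls, rfl, rfl⟩
          exact ⟨_, rfl⟩
    · rcases x with _ | _ | _
      · rw [blockTraj, hwaitInA, hwaitIn]
        simp only [a_cons_eq_blockWord_iff]
        constructor
        · rintro ⟨l, ls, rfl⟩
          exact ⟨_, _, l, ls, rfl, rfl⟩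
        · rintro ⟨_, _, l, ls, h, rfl⟩
          exact ⟨l, ls, rfl⟩
      · rw [blockTraj, hwaitInB, hd]
        simp [b_cons_eq_blockWord_iff]
      · rw [blockTraj, hwaitInS, hwait]
        simp only [sharp_cons_eq_blockWord_iff]
        constructor
        · rintro ⟨ls, rfl⟩
          exact ⟨0, ls, ls, rfl, rfl⟩
        · rintro ⟨_, _, ls, h, rfl⟩
          exact ⟨ls, rfl⟩
    · rcases x with _ | _ | _
      · rw [blockTraj, hpopA, hd]
        cases r <;> simp [List.replicate_succ]
      · rcases r with _ | r
        · refine (hd k [.bot]).trans ?_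
          simp
        · rw [blockTraj, hpopB, hpop]
          simp [List.replicate_succ]
      · rw [blockTraj, hpopS, hd]
        cases r <;> simp [List.replicate_succ]

theorem blockTraj_init_accept_iff (k : ℕ) (w : List Letter) :
    (blockTraj k w blockPDA.init).1 ∈ blockPDA.F ↔
      ∃ ls m, w = blockWord ls m ∧ ls[k]? = some m :=
  (blockTraj_accept_iff w).1 k

theorem blockAdvance_eq_of_ne_idle (ch ch' : Bool) (x : Letter) {q : BlockState} (hq : q ≠ .idle)
    (β : List BlockSym) : blockAdvance ch x (q, β) = blockAdvance ch' x (q, β) := by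
  rcases β with _ | ⟨X, β⟩
  · rfl
  · cases q <;> cases x <;> cases X <;> first | rfl | exact absurd rfl hq

theorem blockAdvance_fst_chosen (ch : Bool) (x : Letter) {q : BlockState}
    (hq : q ≠ .idle ∧ q ≠ .skip) (β : List BlockSym) :
    (blockAdvance ch x (q, β)).1 ≠ .idle ∧ (blockAdvance ch x (q, β)).1 ≠ .skip := by
  rcases β with _ | ⟨X, β⟩
  · exact hq
  · cases q <;> cases x <;> cases X <;> simp_all [blockAdvance, blockNext]

/-- Only `idle` offers a choice, so a run is given by the number of blocks it skips. A run that
never chooses is also a trajectory, with `k` large enough for the word to end before the choice. -/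
theorem blockPDA_run_eq_traj {c d : PDA.Conf BlockState BlockSym} {w : List Letter}
    (h : blockPDA.Run c w d) :
    (c = (.idle, [.bot]) → ∃ k, d = blockTraj k w c) ∧
    (c = (.skip, [.bot]) → ∃ k, d = blockTraj (k + 1) w c) ∧
    (c.1 ≠ .idle ∧ c.1 ≠ .skip → ∀ k, d = blockTraj k w c) := by
  induction h with
  | refl c => exact ⟨fun _ => ⟨0, rfl⟩, fun _ => ⟨0, rfl⟩, fun _ _ => rfl⟩
  | eps h t ih =>
    rw [blockPDA_step_iff] at h
    obtain ⟨-, x, ch, h, -⟩ := h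
    cases h
  | @read c c' d x w h t ih =>
    rw [blockPDA_step_iff] at h
    obtain ⟨-, x, ch, h, rfl⟩ := h
    cases h
    obtain ⟨hidle, hskip, hrest⟩ := ih
    refine ⟨?_, ?_, ?_⟩
    · rintro rfl
      cases ch
      · cases x
        · obtain ⟨k, hk⟩ := hskip rfl
          exact ⟨k + 1, hk⟩
        · exact ⟨0, hrest (by simp [blockAdvance, blockNext]) 0⟩
        · obtain ⟨k, hk⟩ := hidle rfl
          exact ⟨k + 1, hk⟩
      · refine ⟨0, hrest ?_ _⟩
        cases x <;> simp [blockAdvance, blockNext]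
    · rintro rfl
      cases x
      · obtain ⟨k, hk⟩ := hskip rfl
        exact ⟨k, hk⟩
      · exact ⟨0, hrest (by simp [blockAdvance, blockNext]) 1⟩
      · obtain ⟨k, hk⟩ := hidle rfl
        exact ⟨k, hk⟩
    · obtain ⟨q, β⟩ := c
      intro hc k
      rw [hrest (blockAdvance_fst_chosen ch x hc β) (k - if x = .sharp then 1 else 0), blockTraj,
        blockAdvance_eq_of_ne_idle ch (decide (k = 0)) x hc.1]

theorem blockTraj_step (k : ℕ) (w : List Letter) (x : Letter) :
    blockPDA.Step (blockTraj k w blockPDA.init) (some x)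
      (blockTraj k (w ++ [x]) blockPDA.init) := by
  rw [blockPDA_step_iff]
  obtain ⟨q, r, h⟩ := blockTraj_counterStack k w .idle 0
  refine ⟨?_, x, _, rfl, blockTraj_concat k w x _⟩
  rw [show blockPDA.init = (.idle, counterStack 0) from rfl, h]
  exact counterStack_ne_nil r

theorem PDA.Run.concat {Q A G : Type} {P : PDA Q A G} {c d e : PDA.Conf Q G} {w : List A} {x : A}
    (h : P.Run c w d) (h' : P.Step d (some x) e) : P.Run c (w ++ [x]) e := by
  induction h with
  | refl c => exact .read h' (.refl _)
  | eps h t ih => exact .eps h (ih h')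
  | read h t ih => exact .read h (ih h')

theorem blockTraj_run (k : ℕ) (w : List Letter) :
    blockPDA.Run blockPDA.init w (blockTraj k w blockPDA.init) := by
  induction w using List.reverseRecOn with
  | nil => exact .refl _
  | append_singleton w x ih => exact ih.concat (blockTraj_step k w x)

theorem blockPDA_language : blockPDA.language = Lblock := by
  ext w
  constructor
  · rintro ⟨d, h, hd⟩
    obtain ⟨k, rfl⟩ := (blockPDA_run_eq_traj h).1 rfl
    obtain ⟨ls, m, rfl, hm⟩ := (blockTraj_init_accept_iff k w).1 hd
    exact ⟨ls, m, List.mem_of_getElem? hm, rfl⟩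
  · rintro ⟨ls, m, hm, rfl⟩
    obtain ⟨k, hk⟩ := List.mem_iff_getElem?.1 hm
    exact ⟨_, blockTraj_run k _, (blockTraj_init_accept_iff k _).2 ⟨ls, m, rfl, hk⟩⟩

theorem blockPDA_isWinning (n : ℕ) :
    blockPDA.IsWinning n (fun w (i : Fin n) => blockTraj i w blockPDA.init) where
  start _ := rfl
  move w x _ i := ⟨_, .refl, blockTraj_step i w x⟩
  win w hw h := by
    rw [blockPDA_language] at h
    obtain ⟨ls, m, hm, rfl⟩ := h
    obtain ⟨k, hk⟩ := List.mem_iff_getElem?.1 hm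
    have hk' : k < ls.length := (List.getElem?_eq_some_iff.1 hk).1
    -- Each block contributes its separator, so there are at most `n` blocks and token `k` exists.
    have := length_le_length_blockWord ls m
    exact ⟨⟨k, by omega⟩, (blockTraj_init_accept_iff k _).2 ⟨ls, m, rfl, hk⟩⟩

/-! ### Runs and derivation trees -/

namespace PDA

variable {Q A G : Type}

theorem Run.trans {P : PDA Q A G} {c d e : Conf Q G} {v w : List A}
    (h : P.Run c v d) (h' : P.Run d w e) : P.Run c (v ++ w) e := by
  induction h with
  | refl c => exact h'
  | eps h t ih => exact .eps h (ih h')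
  | read h t ih => exact .read h (ih h')

theorem Step.append {P : PDA Q A G} {c d : Conf Q G} {o : Option A} (h : P.Step c o d)
    (β : List G) : P.Step (c.1, c.2 ++ β) o (d.1, d.2 ++ β) := by
  obtain ⟨h⟩ := h
  simpa using Step.mk (P := P) h

theorem Run.append {P : PDA Q A G} {c d : Conf Q G} {w : List A} (h : P.Run c w d)
    (β : List G) : P.Run (c.1, c.2 ++ β) w (d.1, d.2 ++ β) := by
  induction h with
  | refl c => exact .refl _
  | eps h t ih => exact .eps (h.append β) ih
  | read h t ih => exact .read (h.append β) ih

theorem Run.of_step {P : PDA Q A G} {c d : Conf Q G} {o : Option A} (h : P.Step c o d) :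
    P.Run c o.toList d := by
  cases o with
  | none => exact .eps h (.refl _)
  | some a => exact .read h (.refl _)

theorem Run.eq_nil_of_stack_nil {P : PDA Q A G} {c d : Conf Q G} {w : List A} (h : P.Run c w d)
    (hc : c.2 = []) : w = [] := by
  cases h with
  | refl => rfl
  | eps h t => obtain ⟨h⟩ := h; simp at hc
  | read h t => obtain ⟨h⟩ := h; simp at hc

theorem TokenMove.run {P : PDA Q A G} {c d : Conf Q G} {a : A} (h : P.TokenMove c a d) :
    P.Run c [a] d := by
  obtain ⟨c', h, h'⟩ := h
  induction h using Relation.ReflTransGen.head_induction_on with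
  | refl => exact .read h' (.refl _)
  | head h _ ih => exact .eps h ih

/-- The positions of one token after nested prefixes lie on one run, so two acceptances of a token
are two acceptances along a run. -/
theorem IsWinning.run {P : PDA Q A G} {n k : ℕ} {σ : Strategy Q A G k} (h : P.IsWinning n σ)
    (u v : List A) (huv : (u ++ v).length ≤ n) (l : Fin k) :
    P.Run (σ u l) v (σ (u ++ v) l) := by
  induction v using List.reverseRecOn with
  | nil => simpa using Run.refl _
  | append_singleton v a ih =>
    rw [← List.append_assoc] at huv ⊢
    rw [List.length_append, List.length_singleton] at huv
    exact (ih (by omega)).trans (h.move _ _ (by omega) l).run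

/-- `P.Pops q X w q'`: the automaton can read `w` from state `q` with stack `X` and end in state
`q'` with an empty stack, presented by derivation trees. -/
inductive Pops (P : PDA Q A G) : Q → G → List A → Q → Prop
  | pop {q q' : Q} {X : G} {o : Option A} (h : (q', []) ∈ P.δ q o X) : Pops P q X o.toList q'
  | one {q r q' : Q} {X Y : G} {o : Option A} {w : List A} (h : (r, [Y]) ∈ P.δ q o X)
      (t : Pops P r Y w q') : Pops P q X (o.toList ++ w) q'
  | two {q r s q' : Q} {X Y Z : G} {o : Option A} {v w : List A} (h : (r, [Y, Z]) ∈ P.δ q o X)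
      (t : Pops P r Y v s) (t' : Pops P s Z w q') : Pops P q X (o.toList ++ (v ++ w)) q'

theorem Pops.run {P : PDA Q A G} {q q' : Q} {X : G} {w : List A} (h : P.Pops q X w q') :
    P.Run (q, [X]) w (q', []) := by
  induction h with
  | pop h => exact .of_step (.mk h)
  | one h t ih => exact (Run.of_step (.mk h)).trans ih
  | @two q r s q' X Y Z o v w h t t' ih ih' =>
    exact (Run.of_step (.mk h)).trans ((ih.append [Z]).trans ih')

/-- Reading a word while popping a whole stack. -/
inductive PopsList (P : PDA Q A G) : Q → List G → List A → Q → Prop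
  | nil (q : Q) : PopsList P q [] [] q
  | cons {q r q' : Q} {X : G} {β : List G} {v w : List A} (h : P.Pops q X v r)
      (t : PopsList P r β w q') : PopsList P q (X :: β) (v ++ w) q'

/-- The bound on pushed words enters here: lengths zero, one and two correspond to the three
constructors of `Pops`, as in the triple construction of a grammar. -/
theorem PopsList.of_step {P : PDA Q A G} {q r q' : Q} {X : G} {γ β : List G} {o : Option A}
    {w : List A} (h : (r, γ) ∈ P.δ q o X) (t : P.PopsList r (γ ++ β) w q') :
    P.PopsList q (X :: β) (o.toList ++ w) q' := by
  have hl := P.length_le_two _ _ _ _ _ h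
  match γ, hl with
  | [], _ => exact .cons (.pop h) t
  | [Y], _ =>
    cases t with
    | cons h1 t =>
      rw [← List.append_assoc]
      exact .cons (.one h h1) t
  | [Y, Z], _ =>
    cases t with
    | cons h1 t =>
      cases t with
      | cons h2 t =>
        rw [← List.append_assoc (_ : List A) (_ : List A) (_ : List A),
          ← List.append_assoc (_ : List A) (_ : List A) (_ : List A), List.append_assoc o.toList]
        exact .cons (.two h h1 h2) t

theorem Run.popsList {P : PDA Q A G} {c d : Conf Q G} {w : List A} (h : P.Run c w d)
    (hd : d.2 = []) : P.PopsList c.1 c.2 w d.1 := by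
  induction h with
  | refl c => rw [hd]; exact .nil _
  | eps h t ih =>
    obtain ⟨h⟩ := h
    exact .of_step h (ih hd)
  | read h t ih =>
    obtain ⟨h⟩ := h
    exact .of_step (o := some _) h (ih hd)

theorem Run.pops {P : PDA Q A G} {q q' : Q} {X : G} {w : List A}
    (h : P.Run (q, [X]) w (q', [])) : P.Pops q X w q' := by
  cases h.popsList rfl with
  | cons h t =>
    cases t
    simpa using h

/-- `P.Context a v b y`: a derivation tree for `b` can be completed to one for `a`, adding `v` on
the left and `y` on the right. -/
def Context (P : PDA Q A G) (a : Q × G × Q) (v : List A) (b : Q × G × Q) (y : List A) : Prop :=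
  ∀ x, P.Pops b.1 b.2.1 x b.2.2 → P.Pops a.1 a.2.1 (v ++ x ++ y) a.2.2

theorem Context.refl (P : PDA Q A G) (a : Q × G × Q) : P.Context a [] a [] := by
  intro x h
  simpa using h

theorem Context.trans {P : PDA Q A G} {a b c : Q × G × Q} {v y v' y' : List A}
    (h : P.Context a v b y) (h' : P.Context b v' c y') :
    P.Context a (v ++ v') c (y' ++ y) := by
  intro x hx
  simpa using h _ (h' _ hx)

theorem Context.iterate {P : PDA Q A G} {a : Q × G × Q} {v y : List A}
    (h : P.Context a v a y) (n : ℕ) :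
    P.Context a (List.replicate n v).flatten a (List.replicate n y).flatten := by
  induction n with
  | zero => exact .refl P a
  | succ n ih =>
    have := h.trans ih
    rwa [List.replicate_succ, List.replicate_succ', List.flatten_cons, List.flatten_append,
      List.flatten_singleton]

/-- An occurrence of a pair of nested derivation trees for the same symbol in a derivation tree for
`a` and `w`. The inner tree has the same key `φ` as the outer one, but fewer marked letters;
the number of marked letters of a word following `u` is measured by the growth of `p`. -/
def HasPump (P : PDA Q A G) {κ : Type} (φ : List A → κ) (p : List A → ℕ) (u : List A)
    (a : Q × G × Q) (w : List A) : Prop :=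
  ∃ (b : Q × G × Q) (v₁ v x y y₁ : List A), w = v₁ ++ (v ++ x ++ y) ++ y₁ ∧
    P.Context a v₁ b y₁ ∧ P.Context b v b y ∧ P.Pops b.1 b.2.1 x b.2.2 ∧ φ (v ++ x ++ y) = φ x ∧
    p (u ++ v₁) + p (u ++ v₁ ++ v ++ x) < p (u ++ v₁ ++ v) + p (u ++ v₁ ++ v ++ x ++ y)

theorem HasPump.context {P : PDA Q A G} {κ : Type} {φ : List A → κ} {p : List A → ℕ}
    {u v y w : List A} {a b : Q × G × Q} (h : P.HasPump φ p (u ++ v) b w)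
    (hc : P.Context a v b y) : P.HasPump φ p u a (v ++ w ++ y) := by
  obtain ⟨c, v₁, v', x, y', y₁, rfl, h1, h2, h3, h4, h5⟩ := h
  refine ⟨c, v ++ v₁, v', x, y', y₁ ++ y, by simp, hc.trans h1, h2, h3, h4, ?_⟩
  simpa using h5

/-- A subtree of a derivation tree for `a` and `w` with key in `S`. -/
def HasKey (P : PDA Q A G) {κ : Type} (φ : List A → κ) (a : Q × G × Q) (w : List A)
    (S : Finset ((Q × G × Q) × κ)) : Prop :=
  ∃ (b : Q × G × Q) (v x y : List A), w = v ++ x ++ y ∧ P.Context a v b y ∧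
    P.Pops b.1 b.2.1 x b.2.2 ∧ (b, φ x) ∈ S

theorem HasKey.context {P : PDA Q A G} {κ : Type} {φ : List A → κ}
    {v y w : List A} {a b : Q × G × Q} {S : Finset ((Q × G × Q) × κ)}
    (h : P.HasKey φ b w S) (hc : P.Context a v b y) : P.HasKey φ a (v ++ w ++ y) S := by
  obtain ⟨c, v₁, x, y₁, rfl, h1, h2, h3⟩ := h
  exact ⟨c, v ++ v₁, x, y₁ ++ y, by simp, hc.trans h1, h2, h3⟩

/-! ### An Ogden-type pumping lemma -/

section Pumping

variable [Fintype Q] [Fintype G] [DecidableEq Q] [DecidableEq G] {κ : Type} [Fintype κ]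
  [DecidableEq κ] {P : PDA Q A G} {φ : List A → κ} {p : List A → ℕ}

/-- Inductive step from a node `a` to a child `b` rich in marked letters. If a marked letter lies
outside the child, the key of `a` joins `S`: the exponent drops by one, and a descendant repeating
this key yields a pump with `a` as outer tree. Otherwise the child contains all marked letters and
`S` is kept. -/
theorem hasPump_or_hasKey_of_context (hmono : ∀ u v, p u ≤ p (u ++ v))
    {a b : Q × G × Q} {v w y : List A} (hc : P.Context a v b y)
    (ih : ∀ (S : Finset ((Q × G × Q) × κ)) (u : List A), p u + 3 ^ Sᶜ.card < p (u ++ w) →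
      P.HasPump φ p u b w ∨ P.HasKey φ b w S)
    {S : Finset ((Q × G × Q) × κ)} {u : List A} (hS : (a, φ (v ++ w ++ y)) ∉ S)
    (hbig : p (u ++ v) + 3 ^ (Sᶜ.card - 1) < p (u ++ v ++ w))
    (hM : p u + 3 ^ Sᶜ.card < p (u ++ v ++ w ++ y)) :
    P.HasPump φ p u a (v ++ w ++ y) ∨ P.HasKey φ a (v ++ w ++ y) S := by
  by_cases hlt : p u + p (u ++ v ++ w) < p (u ++ v) + p (u ++ v ++ w ++ y)
  · have hcard : (insert (a, φ (v ++ w ++ y)) S)ᶜ.card = Sᶜ.card - 1 := by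
      rw [Finset.compl_insert, Finset.card_erase_of_mem (by simpa using hS)]
    rcases ih (insert (a, φ (v ++ w ++ y)) S) (u ++ v) (by rwa [hcard]) with h | h
    · exact .inl (h.context hc)
    · obtain ⟨c, v₁, x, y₁, rfl, h1, h2, h3⟩ := h
      rcases Finset.mem_insert.1 h3 with h3 | h3
      · obtain ⟨rfl, hφ⟩ := Prod.mk.inj h3
        refine .inl ⟨c, [], v ++ v₁, x, y₁ ++ y, [], by simp, .refl P c, hc.trans h1, h2,
          by rw [hφ]; simp, ?_⟩
        have m1 := hmono (u ++ v) v₁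
        have m2 := hmono (u ++ v ++ v₁ ++ x) y₁
        simp only [← List.append_assoc, List.append_nil] at hlt m1 m2 ⊢
        omega
      · exact .inr (HasKey.context ⟨c, v₁, x, y₁, rfl, h1, h2, h3⟩ hc)
  · rcases ih S (u ++ v) (by omega) with h | h
    · exact .inl (h.context hc)
    · exact .inr (h.context hc)

/-- Descent along a path, where `S` collects the keys of ancestors at which marked letters were
lost; meeting a key of `S` is reported back up to the ancestor that inserted it. A node splits its
word into at most one letter and two subwords. Since `3 ^ k - 1 - 3 ^ (k - 1) ≥ 3 ^ (k - 1)`, one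
subword of a word with more than `3 ^ k` marked letters has more than `3 ^ (k - 1)`. -/
theorem Pops.hasPump_or_hasKey (hmono : ∀ u v, p u ≤ p (u ++ v))
    (hone : ∀ u t, p (u ++ [t]) ≤ p u + 1) {q q' : Q} {X : G} {w : List A}
    (h : P.Pops q X w q') (S : Finset ((Q × G × Q) × κ)) (u : List A)
    (hM : p u + 3 ^ Sᶜ.card < p (u ++ w)) :
    P.HasPump φ p u (q, X, q') w ∨ P.HasKey φ (q, X, q') w S := by
  have hopt : ∀ (u : List A) (o : Option A), p (u ++ o.toList) ≤ p u + 1 := by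
    rintro u (_ | t)
    · simp
    · exact hone u t
  induction h generalizing S u with
  | @pop q q' X o h =>
    have h1 := hopt u o
    have h2 : 0 < 3 ^ Sᶜ.card := by positivity
    omega
  | @one q r q' X Y o w h t ih =>
    by_cases hS : ((q, X, q'), φ (o.toList ++ w)) ∈ S
    · exact .inr ⟨_, [], _, [], by simp, .refl P _, .one h t, hS⟩
    have hpos : 0 < Sᶜ.card := Finset.card_pos.2 ⟨_, Finset.mem_compl.2 hS⟩
    have hpow : 3 ^ Sᶜ.card = 3 * 3 ^ (Sᶜ.card - 1) := by
      rw [← pow_succ', Nat.sub_add_cancel hpos]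
    have h2 : 0 < 3 ^ (Sᶜ.card - 1) := by positivity
    have h1 := hopt u o
    have hc : P.Context (q, X, q') o.toList (r, Y, q') [] := fun x hx => by
      simpa using Pops.one h hx
    rw [← List.append_assoc] at hM
    have := hasPump_or_hasKey_of_context (S := S) (u := u) hmono hc ih (by simpa using hS)
      (by omega) (by simpa using hM)
    simpa using this
  | @two q r s q' X Y Z o v w h t t' ih ih' =>
    by_cases hS : ((q, X, q'), φ (o.toList ++ (v ++ w))) ∈ S
    · exact .inr ⟨_, [], _, [], by simp, .refl P _, .two h t t', hS⟩
    have hpos : 0 < Sᶜ.card := Finset.card_pos.2 ⟨_, Finset.mem_compl.2 hS⟩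
    have hpow : 3 ^ Sᶜ.card = 3 * 3 ^ (Sᶜ.card - 1) := by
      rw [← pow_succ', Nat.sub_add_cancel hpos]
    have h2 : 0 < 3 ^ (Sᶜ.card - 1) := by positivity
    have h1 := hopt u o
    simp only [← List.append_assoc] at hM
    by_cases hbig : p (u ++ o.toList) + 3 ^ (Sᶜ.card - 1) < p (u ++ o.toList ++ v)
    · have hc : P.Context (q, X, q') o.toList (r, Y, s) w := fun x hx => by
        simpa using Pops.two h hx t'
      have := hasPump_or_hasKey_of_context (S := S) (u := u) hmono hc ih (by simpa using hS) hbig hM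
      simpa using this
    · have hc : P.Context (q, X, q') (o.toList ++ v) (s, Z, q') [] := fun x hx => by
        simpa using Pops.two h t hx
      have := hasPump_or_hasKey_of_context (S := S) (u := u) hmono hc ih' (by simpa using hS)
        (by simp only [← List.append_assoc]; omega) (by simpa using hM)
      simpa using this

theorem Pops.hasPump (hmono : ∀ u v, p u ≤ p (u ++ v))
    (hone : ∀ u t, p (u ++ [t]) ≤ p u + 1) {q q' : Q} {X : G} {w : List A}
    (h : P.Pops q X w q') (hM : p [] + 3 ^ Fintype.card ((Q × G × Q) × κ) < p w) :
    P.HasPump φ p [] (q, X, q') w := by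
  rcases h.hasPump_or_hasKey (φ := φ) hmono hone ∅ [] (by simpa using hM) with h | h
  · exact h
  · obtain ⟨b, v, x, y, -, -, -, h⟩ := h
    simp at h

end Pumping

/-! ### Marking the first of two acceptances -/

/-- The moves of `twoPhase P`, see there. -/
inductive TwoPhaseMove (P : PDA Q A G) :
    Option Q → Option (Option A) → G → Option Q × List G → Prop
  | step {q q' : Q} {o : Option A} {X : G} {γ : List G} (h : (q', γ) ∈ P.δ q o X) :
      TwoPhaseMove P (some q) (o.map some) X (some q', γ)
  | mark {q : Q} {X : G} (h : q ∈ P.F) : TwoPhaseMove P (some q) (some none) X (some q, [X])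
  | leave {q : Q} {X : G} (h : q ∈ P.F) : TwoPhaseMove P (some q) none X (none, [])
  | drain {X : G} : TwoPhaseMove P none none X (none, [])

/-- The automaton that simulates `P`, may read the extra letter `none` in accepting states only,
and may empty its stack from accepting states, in the extra state `none`. -/
def twoPhase (P : PDA Q A G) : PDA (Option Q) (Option A) G where
  δ q o X := {y | P.TwoPhaseMove q o X y}
  length_le_two := by
    intro q o X q' γ h
    cases h with
    | step h => exact P.length_le_two _ _ _ _ _ h
    | mark h => simp
    | leave h => simp
    | drain => simp
  q₀ := some P.q₀
  Z₀ := P.Z₀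
  F := insert none (some '' P.F)

theorem Step.twoPhase {P : PDA Q A G} {c d : Conf Q G} {o : Option A} (h : P.Step c o d) :
    P.twoPhase.Step (some c.1, c.2) (o.map some) (some d.1, d.2) := by
  obtain ⟨h⟩ := h
  exact .mk (TwoPhaseMove.step h)

theorem Run.twoPhase {P : PDA Q A G} {c d : Conf Q G} {w : List A} (h : P.Run c w d) :
    P.twoPhase.Run (some c.1, c.2) (w.map some) (some d.1, d.2) := by
  induction h with
  | refl c => exact .refl _
  | eps h t ih => exact .eps h.twoPhase ih
  | read h t ih => exact .read h.twoPhase ih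

theorem twoPhase_run_drain (P : PDA Q A G) (β : List G) :
    P.twoPhase.Run (none, β) [] (none, []) := by
  induction β with
  | nil => exact .refl _
  | cons X β ih => exact .eps (.mk TwoPhaseMove.drain) ih

/-- Derivation trees require the stack to be emptied, hence the draining phase. If `P` has already
emptied its stack in `d`, no move is left, which is why accepting states of `P` stay final. Reading
the mark needs a stack symbol, and `w ≠ []` provides one. -/
theorem exists_twoPhase_run {P : PDA Q A G} {c d : Conf Q G} {v w : List A}
    (h : P.Run P.init v c) (hc : c.1 ∈ P.F) (h' : P.Run c w d) (hd : d.1 ∈ P.F) (hw : w ≠ []) :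
    ∃ r ∈ P.twoPhase.F,
      P.twoPhase.Run P.twoPhase.init (v.map some ++ none :: w.map some) (r, []) := by
  have hrun : P.twoPhase.Run P.twoPhase.init (v.map some ++ none :: w.map some)
      (some d.1, d.2) := by
    refine h.twoPhase.trans ?_
    obtain ⟨q, _ | ⟨X, β⟩⟩ := c
    · exact absurd (h'.eq_nil_of_stack_nil rfl) hw
    · exact .read (.mk (TwoPhaseMove.mark hc)) h'.twoPhase
  obtain ⟨q, _ | ⟨X, β⟩⟩ := d
  · exact ⟨some q, .inr ⟨q, hd, rfl⟩, hrun⟩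
  · refine ⟨none, .inl rfl, ?_⟩
    have := hrun.trans (.eps (.mk (TwoPhaseMove.leave hd)) (P.twoPhase_run_drain β))
    simpa using this

/-- Once the simulation is left nothing more is read, so the mark and all letters are read while `P`
is being simulated. -/
theorem twoPhase_run_none {P : PDA Q A G} {c d : Conf (Option Q) G} {w : List (Option A)}
    (h : P.twoPhase.Run c w d) (hc : c.1 = none) : w = [] := by
  induction h with
  | refl => rfl
  | eps h t ih =>
    obtain ⟨h⟩ := h
    cases hc
    generalize (none : Option (Option A)) = o at h
    cases h
    exact ih rfl
  | read h t ih =>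
    obtain ⟨h⟩ := h
    cases hc
    generalize ho : some _ = o at h
    cases h
    simp at ho

theorem exists_run_of_twoPhase_run {P : PDA Q A G} {c d : Conf (Option Q) G}
    {z : List (Option A)} (h : P.twoPhase.Run c z d) (hd : d.1 ∈ P.twoPhase.F) {q : Q}
    (hc : c.1 = some q) {v : List A} (hz : z = v.map some) :
    ∃ e, P.Run (q, c.2) v e ∧ e.1 ∈ P.F := by
  induction h generalizing q v with
  | refl c =>
    obtain rfl : v = [] := by simpa using hz.symm
    obtain h | ⟨q', h, h'⟩ := hd
    · simp [hc] at h
    · rw [hc] at h'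
      cases h'
      exact ⟨_, .refl _, h⟩
  | eps h t ih =>
    obtain ⟨h⟩ := h
    cases hc
    generalize ho : none = o at h
    cases h with
    | @step _ q' o _ γ h =>
      cases o with
      | some => simp at ho
      | none =>
        obtain ⟨e, he, he'⟩ := ih hd rfl hz
        exact ⟨e, .eps (.mk h) he, he'⟩
    | mark h => simp at ho
    | leave h =>
      have := twoPhase_run_none t rfl
      subst this
      obtain rfl : v = [] := by simpa using hz.symm
      exact ⟨_, .refl _, h⟩
  | read h t ih =>
    obtain ⟨h⟩ := h
    cases hc
    obtain _ | ⟨x, v⟩ := v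
    · simp at hz
    rw [List.map_cons] at hz
    obtain ⟨rfl, hz'⟩ := List.cons.inj hz
    generalize ho : some (some x) = o at h
    cases h with
    | @step _ q' o _ γ h =>
      cases o with
      | none => simp at ho
      | some x' =>
        obtain rfl : x = x' := by simpa using ho
        obtain ⟨e, he, he'⟩ := ih hd rfl hz'
        exact ⟨e, .read (.mk h) he, he'⟩
    | mark h => simp at ho
    | leave h => simp at ho

theorem exists_two_runs_of_twoPhase_run {P : PDA Q A G} {c d : Conf (Option Q) G}
    {z : List (Option A)} (h : P.twoPhase.Run c z d) (hd : d.1 ∈ P.twoPhase.F) {q : Q}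
    (hc : c.1 = some q) {v w : List A} (hz : z = v.map some ++ none :: w.map some) :
    ∃ e e', P.Run (q, c.2) v e ∧ e.1 ∈ P.F ∧ P.Run e w e' ∧ e'.1 ∈ P.F := by
  induction h generalizing q v with
  | refl c => simp at hz
  | eps h t ih =>
    obtain ⟨h⟩ := h
    cases hc
    generalize ho : none = o at h
    cases h with
    | @step _ q' o _ γ h =>
      cases o with
      | some => simp at ho
      | none =>
        obtain ⟨e, e', he, he'⟩ := ih hd rfl hz
        exact ⟨e, e', .eps (.mk h) he, he'⟩
    | mark h => simp at ho
    | leave h =>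
      have := twoPhase_run_none t rfl
      subst this
      simp at hz
  | read h t ih =>
    obtain ⟨h⟩ := h
    cases hc
    obtain _ | ⟨x, v⟩ := v
    · rw [List.map_nil, List.nil_append] at hz
      obtain ⟨rfl, hz'⟩ := List.cons.inj hz
      generalize ho : some none = o at h
      cases h with
      | @step _ q' o _ γ h => cases o <;> simp at ho
      | mark h =>
        obtain ⟨e, he, he'⟩ := exists_run_of_twoPhase_run t hd rfl hz'
        exact ⟨_, e, .refl _, h, he, he'⟩
      | leave h => simp at ho
    · rw [List.map_cons, List.cons_append] at hz
      obtain ⟨rfl, hz'⟩ := List.cons.inj hz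
      generalize ho : some (some x) = o at h
      cases h with
      | @step _ q' o _ γ h =>
        cases o with
        | none => simp at ho
        | some x' =>
          obtain rfl : x = x' := by simpa using ho
          obtain ⟨e, e', he, he'⟩ := ih hd rfl hz'
          exact ⟨e, e', .read (.mk h) he, he'⟩
      | mark h => simp at ho
      | leave h => simp at ho

theorem mem_language_of_twoPhase_run {P : PDA Q A G} {r : Option Q} {v w : List A}
    (h : P.twoPhase.Run P.twoPhase.init (v.map some ++ none :: w.map some) (r, []))
    (hr : r ∈ P.twoPhase.F) : v ∈ P.language ∧ v ++ w ∈ P.language := by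
  obtain ⟨e, e', he, he', h1, h2⟩ := exists_two_runs_of_twoPhase_run h hr rfl rfl
  exact ⟨⟨e, he, he'⟩, ⟨e', he.trans h1, h2⟩⟩

end PDA

/-! ### Segments between separators -/

section Segments

/-- The separators of words over `Option Letter`. -/
def isSep : Option Letter → Bool
  | none => true
  | some .sharp => true
  | some .a => false
  | some .b => false

/-- The number of separators in a word. -/
def sepCount (w : List (Option Letter)) : ℕ := (w.filter isSep).length

/-- `segLength w g` is the number of letters of `w` that are not separators and are preceded by
exactly `g` separators. -/
def segLength : List (Option Letter) → ℕ → ℕ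
  | [], _ => 0
  | t :: w, g =>
    if isSep t then (if g = 0 then 0 else segLength w (g - 1))
    else (if g = 0 then 1 else 0) + segLength w g

theorem sepCount_append (v w : List (Option Letter)) :
    sepCount (v ++ w) = sepCount v + sepCount w := by
  simp [sepCount]

theorem segLength_append (v w : List (Option Letter)) (g : ℕ) :
    segLength (v ++ w) g =
      segLength v g + if sepCount v ≤ g then segLength w (g - sepCount v) else 0 := by
  induction v generalizing g with
  | nil => simp [segLength, sepCount]
  | cons t v ih =>
    by_cases ht : isSep t
    · have hs : sepCount (t :: v) = sepCount v + 1 := by simp [sepCount, ht]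
      rcases g with _ | g
      · simp [segLength, ht, hs]
      · simp [segLength, ht, hs, ih]
    · have hs : sepCount (t :: v) = sepCount v := by simp [sepCount, ht]
      simp only [List.cons_append, segLength, ht, hs, ih]
      simp [Nat.add_assoc]

theorem segLength_of_sepCount_eq_zero {w : List (Option Letter)} (h : sepCount w = 0) (g : ℕ) :
    segLength w g = if g = 0 then w.length else 0 := by
  induction w with
  | nil => simp [segLength]
  | cons t w ih =>
    by_cases ht : isSep t
    · simp [sepCount, ht] at h
    · have hs : sepCount (t :: w) = sepCount w := by simp [sepCount, ht]
      rw [segLength, ih (hs ▸ h)]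
      simp only [ht]
      split_ifs <;> simp_all [Nat.add_comm]

theorem segLength_concat_le (w : List (Option Letter)) (t : Option Letter) (g : ℕ) :
    segLength (w ++ [t]) g ≤ segLength w g + 1 := by
  rw [segLength_append]
  have : ∀ g, segLength [t] g ≤ 1 := by
    intro g
    simp only [segLength]
    split_ifs <;> simp
  split_ifs
  · have := this (g - sepCount w)
    omega
  · omega

theorem filter_isSep_of_sepCount_eq_zero {w : List (Option Letter)} (h : sepCount w = 0) :
    w.filter isSep = [] :=
  List.length_eq_zero_iff.1 h

theorem filter_isSep_power {w : List (Option Letter)} (h : sepCount w = 0) (n : ℕ) :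
    (List.replicate n w).flatten.filter isSep = [] := by
  have := filter_isSep_of_sepCount_eq_zero h
  induction n with
  | zero => rfl
  | succ n ih => rw [List.replicate_succ, List.flatten_cons, List.filter_append, this, ih]; rfl

theorem segLength_append_of_sepCount_eq_zero (u : List (Option Letter))
    {v : List (Option Letter)} (h : sepCount v = 0) (g : ℕ) :
    segLength (u ++ v) g = segLength u g + if g = sepCount u then v.length else 0 := by
  rw [segLength_append, segLength_of_sepCount_eq_zero h]
  split_ifs <;> omega

/-- Free of separators, all copies of `v` stay in segment `sepCount v₁` and all copies of `y` in
segment `sepCount v₁ + sepCount x`. With exponent `n + 1`, exactly `n` copies are new. -/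
theorem segLength_pump {v₁ v x y y₁ : List (Option Letter)} (hv : sepCount v = 0)
    (hy : sepCount y = 0) (n g : ℕ) :
    segLength (v₁ ++ ((List.replicate (n + 1) v).flatten ++ x ++
        (List.replicate (n + 1) y).flatten) ++ y₁) g =
      segLength (v₁ ++ (v ++ x ++ y) ++ y₁) g +
        n * ((if g = sepCount v₁ then v.length else 0) +
          if g = sepCount v₁ + sepCount x then y.length else 0) := by
  have hv' : sepCount (List.replicate (n + 1) v).flatten = 0 := by
    rw [sepCount, filter_isSep_power hv]; rfl
  have hy' : sepCount (List.replicate (n + 1) y).flatten = 0 := by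
    rw [sepCount, filter_isSep_power hy]; rfl
  have hlv : (List.replicate (n + 1) v).flatten.length = n * v.length + v.length := by
    simp [Nat.add_mul]
  have hly : (List.replicate (n + 1) y).flatten.length = n * y.length + y.length := by
    simp [Nat.add_mul]
  simp only [← List.append_assoc]
  rw [segLength_append _ y₁, segLength_append _ y₁, segLength_append_of_sepCount_eq_zero _ hy',
    segLength_append_of_sepCount_eq_zero _ hy, segLength_append _ x, segLength_append _ x,
    segLength_append_of_sepCount_eq_zero _ hv', segLength_append_of_sepCount_eq_zero _ hv]
  simp only [sepCount_append, hv, hv', hy, hy', hlv, hly, Nat.add_zero, Nat.mul_add]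
  split_ifs <;> omega

theorem filter_isSep_pump {v₁ v x y y₁ : List (Option Letter)} (hv : sepCount v = 0)
    (hy : sepCount y = 0) (n : ℕ) :
    (v₁ ++ ((List.replicate n v).flatten ++ x ++ (List.replicate n y).flatten) ++ y₁).filter isSep =
      (v₁ ++ (v ++ x ++ y) ++ y₁).filter isSep := by
  simp only [List.filter_append, filter_isSep_power hv, filter_isSep_power hy,
    filter_isSep_of_sepCount_eq_zero hv, filter_isSep_of_sepCount_eq_zero hy]

theorem filter_isSep_replicate (n : ℕ) {t : Option Letter} (ht : isSep t = false) :
    (List.replicate n t).filter isSep = [] := by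
  simp [ht]

theorem filter_isSep_blockWord (ls : List ℕ) (m : ℕ) :
    ((blockWord ls m).map some).filter isSep = List.replicate ls.length (some .sharp) := by
  induction ls with
  | nil => rw [blockWord_nil, List.map_replicate, filter_isSep_replicate _ rfl]; rfl
  | cons l ls ih =>
    rw [blockWord_cons, List.map_append, List.filter_append, List.map_replicate,
      filter_isSep_replicate _ rfl, List.map_cons, List.filter_cons, ih]
    rfl

theorem sepCount_blockWord (ls : List ℕ) (m : ℕ) :
    sepCount ((blockWord ls m).map some) = ls.length := by
  simp [sepCount, filter_isSep_blockWord]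

theorem segLength_blockWord (ls : List ℕ) (m g : ℕ) :
    segLength ((blockWord ls m).map some) g = (ls ++ [m])[g]?.getD 0 := by
  induction ls generalizing g with
  | nil =>
    rw [blockWord_nil, List.map_replicate, segLength_of_sepCount_eq_zero
      (by rw [sepCount, filter_isSep_replicate _ rfl]; rfl)]
    cases g <;> simp
  | cons l ls ih =>
    have h : sepCount (List.replicate l (some Letter.a)) = 0 := by
      rw [sepCount, filter_isSep_replicate _ rfl]; rfl
    rw [blockWord_cons, List.map_append, List.map_replicate, segLength_append,
      segLength_of_sepCount_eq_zero h, h]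
    cases g <;> simp [segLength, isSep, ih]

theorem exists_map_some_of_filter_isSep {w : List (Option Letter)} (h : w.filter isSep = []) :
    ∃ v : List Letter, w = v.map some := by
  induction w with
  | nil => exact ⟨[], rfl⟩
  | cons t w ih =>
    rcases t with _ | t
    · simp [isSep] at h
    · rw [List.filter_cons] at h
      split_ifs at h
      obtain ⟨v, rfl⟩ := ih h
      exact ⟨t :: v, rfl⟩

/-- Since pumping preserves the sequence of separators, this applies to pumped words, whose shape is
otherwise unknown. -/
theorem exists_split_of_filter_isSep {N : ℕ} {z : List (Option Letter)}
    (h : z.filter isSep = List.replicate N (some .sharp) ++ [none]) :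
    ∃ v w : List Letter, z = v.map some ++ none :: w.map some ∧
      sepCount (v.map some) = N ∧ sepCount (w.map some) = 0 := by
  induction z generalizing N with
  | nil => simp at h
  | cons t z ih =>
    rcases t with _ | t
    · rw [List.filter_cons_of_pos rfl] at h
      rcases N with _ | N
      · have h' : z.filter isSep = [] := (List.cons.inj h).2
        obtain ⟨w, rfl⟩ := exists_map_some_of_filter_isSep h'
        exact ⟨[], w, rfl, rfl, by rw [sepCount, h']; rfl⟩
      · simp [List.replicate_succ] at h
    · by_cases ht : isSep (some t)
      · rcases N with _ | N
        · simp [ht] at h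
        · obtain ⟨v, w, rfl, h1, h2⟩ := ih (N := N) (by
            simpa [List.filter_cons, ht, List.replicate_succ] using
              congrArg List.tail h)
          exact ⟨t :: v, w, rfl, by rw [← h1]; simp [sepCount, ht], h2⟩
      · obtain ⟨v, w, rfl, h1, h2⟩ := ih (N := N) (by simpa [List.filter_cons, ht] using h)
        exact ⟨t :: v, w, rfl, by rw [← h1]; simp [sepCount, ht], h2⟩

theorem exists_segLength_eq_of_mem_Lblock {v : List Letter} (hv : v ∈ Lblock) :
    ∃ g < sepCount (v.map some),
      segLength (v.map some) (sepCount (v.map some)) = segLength (v.map some) g := by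
  obtain ⟨ls, m, hm, rfl⟩ := hv
  obtain ⟨g, hg⟩ := List.mem_iff_getElem?.1 hm
  have hg' : g < ls.length := (List.getElem?_eq_some_iff.1 hg).1
  refine ⟨g, by rwa [sepCount_blockWord], ?_⟩
  rw [sepCount_blockWord, segLength_blockWord, segLength_blockWord,
    List.getElem?_append_left hg', hg]
  simp

/-- Segments `N` and `N + 1` are the `b`s before and after the mark; erasing the mark merges them.
-/
theorem exists_segLength_eq_of_mem_Lblock_of_append_mem {v w : List Letter} {N : ℕ}
    (hv : v ∈ Lblock) (hvw : v ++ w ∈ Lblock) (hN : sepCount (v.map some) = N)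
    (hw : sepCount (w.map some) = 0) :
    (∃ g < N, segLength (v.map some ++ none :: w.map some) N =
      segLength (v.map some ++ none :: w.map some) g) ∧
    ∃ g < N, segLength (v.map some ++ none :: w.map some) N +
        segLength (v.map some ++ none :: w.map some) (N + 1) =
      segLength (v.map some ++ none :: w.map some) g := by
  have h0 : ∀ g ≤ N, segLength (v.map some ++ none :: w.map some) g =
      segLength (v.map some) g := by
    intro g hg
    rw [segLength_append, hN]
    split_ifs
    · rw [show g - N = 0 by omega]; simp [segLength, isSep]
    · rfl
  have h1 : segLength (v.map some) (N + 1) = 0 := by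
    obtain ⟨ls, m, -, rfl⟩ := hv
    rw [sepCount_blockWord] at hN
    rw [segLength_blockWord, List.getElem?_eq_none (by simp [hN])]
    rfl
  have h2 : segLength (v.map some ++ none :: w.map some) (N + 1) = w.length := by
    rw [segLength_append, hN, if_pos (by omega), h1, show N + 1 - N = 1 by omega]
    simp [segLength, isSep, segLength_of_sepCount_eq_zero hw]
  have h3 : ∀ g, segLength ((v ++ w).map some) g =
      segLength (v.map some) g + if g = N then w.length else 0 := by
    intro g
    rw [List.map_append, segLength_append_of_sepCount_eq_zero _ hw, hN, List.length_map]
  constructor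
  · obtain ⟨g, hg, h⟩ := exists_segLength_eq_of_mem_Lblock hv
    rw [hN] at hg h
    exact ⟨g, hg, by rw [h0 _ le_rfl, h0 _ hg.le, h]⟩
  · obtain ⟨g, hg, h⟩ := exists_segLength_eq_of_mem_Lblock hvw
    rw [show sepCount ((v ++ w).map some) = N by
      rw [List.map_append, sepCount_append, hN, hw, Nat.add_zero]] at hg h
    refine ⟨g, hg, ?_⟩
    rw [h3, h3, if_pos rfl, if_neg hg.ne] at h
    rw [h0 _ le_rfl, h0 _ hg.le, h2, h, Nat.add_zero]

end Segments

/-! ### No run matches two different blocks -/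

theorem Nat.eq_and_eq_of_add_mul_eq {n a b x y : ℕ} (ha : a < n) (hb : b < n)
    (h : a + n * x = b + n * y) : a = b ∧ x = y := by
  have h1 := congrArg (· % n) h
  simp only [Nat.add_mul_mod_self_left, Nat.mod_eq_of_lt ha, Nat.mod_eq_of_lt hb] at h1
  subst h1
  exact ⟨rfl, Nat.eq_of_mul_eq_mul_left (by omega) (Nat.add_left_cancel h)⟩

/-- Two coordinates cannot be increased in such a way that coordinate `N` still agrees with one of
the first `N` coordinates and so does the sum of coordinates `N` and `N + 1`. -/
theorem not_exists_eq_of_two_increments {f : ℕ → ℕ} {N i g₁ g₂ α β n : ℕ} (hi : i < N)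
    (hinj : ∀ g < N, f g = f i → g = i) (hN : f N = f i) (hN' : 0 < f (N + 1))
    (hf : ∀ g < N, f g < n) (hn : f N + f (N + 1) < n)
    (he : 0 < (if i = g₁ then α else 0) + if i = g₂ then β else 0)
    (h : ∃ g < N, f N + n * ((if N = g₁ then α else 0) + if N = g₂ then β else 0) =
      f g + n * ((if g = g₁ then α else 0) + if g = g₂ then β else 0))
    (h' : ∃ g < N, f N + n * ((if N = g₁ then α else 0) + if N = g₂ then β else 0) +
        (f (N + 1) + n * ((if N + 1 = g₁ then α else 0) + if N + 1 = g₂ then β else 0)) =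
      f g + n * ((if g = g₁ then α else 0) + if g = g₂ then β else 0)) : False := by
  obtain ⟨g, hg, h⟩ := h
  obtain ⟨g', hg', h'⟩ := h'
  -- Old values are below `n` and increments are multiples of `n`, so residues compare the former
  -- and quotients the latter.
  obtain ⟨h1, h2⟩ := Nat.eq_and_eq_of_add_mul_eq (by omega) (hf g hg) h
  obtain rfl : g = i := hinj g hg (by omega)
  rw [show ∀ a b c d : ℕ, a + n * b + (c + n * d) = (a + c) + n * (b + d) by intros; ring] at h'
  obtain ⟨h3, h4⟩ := Nat.eq_and_eq_of_add_mul_eq hn (hf g' hg') h'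
  -- The old sum exceeds `f g`, so `g'` is another coordinate. But `g` and `N` have the same
  -- positive increment, which uses up `g₁` and `g₂`; hence `g'` does not grow while the sum does.
  have hne : g' ≠ g := by rintro rfl; omega
  clear h h'
  split_ifs at * <;> omega

namespace PDA

/-- For sufficiently long blocks of pairwise different lengths, a single run cannot accept with the
number of letters `b` matching first one block and then another one. -/
theorem not_exists_run_of_language_eq_Lblock {Q G : Type} [Finite Q] [Finite G]
    {P : PDA Q Letter G} (hP : P.language = Lblock) (N : ℕ) :
    ∃ M : ℕ, ∀ ls : List ℕ, ls.length = N → ls.Nodup → (∀ l ∈ ls, M < l) →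
      ∀ l ∈ ls, ∀ t > 0, ∀ c d : Conf Q G, P.Run P.init (blockWord ls l) c → c.1 ∈ P.F →
        P.Run c (List.replicate t .b) d → d.1 ∈ P.F → False := by
  classical
  cases nonempty_fintype Q
  cases nonempty_fintype G
  refine ⟨3 ^ Fintype.card ((Option Q × G × Option Q) × Fin (N + 2)), ?_⟩
  intro ls hlen hnodup hM l hl t ht c d hc hcF hd hdF
  obtain ⟨r, hr, hrun⟩ := exists_twoPhase_run hc hcF hd hdF
    (by rw [Ne, List.replicate_eq_nil_iff]; omega)
  obtain ⟨i, hi, rfl⟩ := List.mem_iff_getElem.1 hl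
  have hb : sepCount ((List.replicate t Letter.b).map some) = 0 := by
    rw [sepCount, List.map_replicate, filter_isSep_replicate _ rfl]; rfl
  set z := (blockWord ls ls[i]).map some ++ none :: (List.replicate t Letter.b).map some with hz
  have hfilter : z.filter isSep = List.replicate N (some .sharp) ++ [none] := by
    rw [hz, List.filter_append, filter_isSep_blockWord, hlen, List.filter_cons,
      filter_isSep_of_sepCount_eq_zero hb]
    rfl
  have hzsep : sepCount z = N + 1 := by simp [sepCount, hfilter]
  have hz0 : ∀ g, segLength z g = (ls ++ [ls[i]])[g]?.getD 0 + if g = N + 1 then t else 0 := by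
    intro g
    rw [hz, segLength_append, segLength_blockWord, sepCount_blockWord, hlen]
    simp only [segLength, isSep, segLength_of_sepCount_eq_zero hb, List.length_map,
      List.length_replicate]
    congr 1
    split_ifs <;> first | rfl | omega
  have hzlt : ∀ g (hg : g < N), segLength z g = ls[g] := by
    intro g hg
    rw [hz0, if_neg (by omega), List.getElem?_append_left (by omega),
      List.getElem?_eq_getElem (by omega)]
    rfl
  have hzN : segLength z N = ls[i] := by
    rw [hz0, if_neg (by omega), List.getElem?_append_right (by omega), hlen]
    simp
  have hzN' : segLength z (N + 1) = t := by
    rw [hz0, if_pos rfl, List.getElem?_eq_none (by simp [hlen])]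
    simp
  -- Truncation only keeps the keys finite. As `z` has `N + 1` separators, factors of `z` with equal
  -- keys have equally many, so the pumped factors have none.
  let φ : List (Option Letter) → Fin (N + 2) := fun x => ⟨min (sepCount x) (N + 1), by omega⟩
  -- The marked letters are those of block `i`, the one matched at the first acceptance.
  have hpump := hrun.pops.hasPump (φ := φ) (p := fun w => segLength w i)
    (fun u v => by rw [segLength_append]; omega) (fun u t => segLength_concat_le u t i)
    (by
      have := hM _ hl
      rw [hzlt i (by omega)]
      simpa [segLength] using this)
  obtain ⟨b, v₁, v, x, y, y₁, hzeq, h1, h2, h3, hφ, hlt⟩ := hpump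
  have hsum : sepCount v₁ + (sepCount v + sepCount x + sepCount y) + sepCount y₁ = N + 1 := by
    rw [← hzsep, hzeq]
    simp only [sepCount_append]
  have hφ' := congrArg Fin.val hφ
  simp only [φ, sepCount_append] at hφ'
  have hv : sepCount v = 0 := by omega
  have hy : sepCount y = 0 := by omega
  simp only [List.nil_append] at hlt
  rw [segLength_append_of_sepCount_eq_zero _ hy, segLength_append_of_sepCount_eq_zero _ hv] at hlt
  simp only [sepCount_append, hv, Nat.add_zero] at hlt
  -- Exceeds every block and the total number of `b`s, so residues modulo `n` recover the old
  -- lengths.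
  set n := ls.sum + segLength z N + segLength z (N + 1) + 1 with hn
  have haccept := (h1 _ (h2.iterate (n + 1) x h3)).run
  obtain ⟨α, β, hαβ, hα, hβ⟩ := exists_split_of_filter_isSep (N := N)
    ((filter_isSep_pump hv hy (n + 1) (v₁ := v₁) (x := x) (y₁ := y₁)).trans
      (by rw [← hzeq, hfilter]))
  have hseg := segLength_pump hv hy n (v₁ := v₁) (x := x) (y₁ := y₁)
  rw [hαβ] at haccept hseg
  obtain ⟨hL, hL'⟩ := mem_language_of_twoPhase_run haccept hr
  rw [hP] at hL hL'
  have hfinal := exists_segLength_eq_of_mem_Lblock_of_append_mem hL hL' hα hβ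
  simp only [hseg, ← hzeq] at hfinal
  refine not_exists_eq_of_two_increments (f := segLength z) (N := N) (i := i) (n := n)
    (by omega) ?_ ?_ ?_ ?_ ?_ ?_ hfinal.1 hfinal.2
  · intro g hg h
    rw [hzlt g hg, hzlt i (by omega)] at h
    exact (hnodup.getElem_inj_iff).1 h
  · rw [hzN, hzlt i (by omega)]
  · omega
  · intro g hg
    have := List.le_sum_of_mem (List.getElem_mem (l := ls) (n := g) (by omega))
    rw [hzlt g hg]
    omega
  · omega
  · omega

end PDA

/-! ### Pigeonhole on tokens and the conclusion -/

theorem Lblock_notMem_ExplCFL_const : Lblock ∉ ExplCFL Letter (BigO fun _ => 1) := by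
  rintro ⟨f, -, hf, Q, G, _, _, P, hP, hexpl⟩
  obtain ⟨c, hc⟩ := Asymptotics.IsBigO.bound hf
  obtain ⟨n₀, hn₀⟩ := Filter.eventually_atTop.1 hc
  set N := ⌈c⌉₊ + 1 with hN
  obtain ⟨M, hM⟩ := PDA.not_exists_run_of_language_eq_Lblock hP N
  set ls := (List.range N).map (fun g => M + 1 + g) with hls
  have hmem : ∀ g < N, M + 1 + g ∈ ls := fun g hg =>
    List.mem_map.2 ⟨g, List.mem_range.2 hg, rfl⟩
  have hlen : ls.length = N := by simp [hls]
  have hnodup : ls.Nodup := List.nodup_range.map (fun x y h => by simpa using h)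
  have hlong : ∀ l ∈ ls, M < l := by
    intro l hl
    obtain ⟨g, -, rfl⟩ := List.mem_map.1 hl
    omega
  have hword : ∀ m, blockWord ls m = blockWord ls 0 ++ List.replicate m Letter.b := by
    intro m
    simp [blockWord]
  -- Leaves room for all blocks and every needed number of `b`s, and lies beyond `n₀`, where `f` is
  -- bounded by `c`.
  set n := n₀ + (blockWord ls 0).length + (M + 1 + N) with hn
  have hfn : f n < N := by
    have := hn₀ n (by omega)
    simp only [Nat.cast_one, norm_one, mul_one, Real.norm_natCast] at this
    have := Nat.cast_le.1 (this.trans (Nat.le_ceil c))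
    omega
  obtain ⟨σ, hσ⟩ := hexpl n
  have hle : ∀ m ≤ M + 1 + N, (blockWord ls m).length ≤ n := by
    intro m hm
    rw [hword, List.length_append, List.length_replicate]
    omega
  have htoken : ∀ g : Fin N, ∃ l : Fin (f n), (σ (blockWord ls (M + 1 + g)) l).1 ∈ P.F := by
    intro g
    refine hσ.win _ (hle _ (by omega)) ?_
    rw [hP]
    exact ⟨ls, _, hmem g g.2, rfl⟩
  choose τ hτ using htoken
  -- The longer word extends the shorter one by `b`s only, so a token accepting after both would
  -- give the excluded run.
  have key : ∀ g g' : Fin N, g < g' → τ g ≠ τ g' := by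
    intro g g' hgg heq
    have hgg' : (g : ℕ) < g' := hgg
    have happ : blockWord ls (M + 1 + g) ++ List.replicate (g' - g : ℕ) Letter.b =
        blockWord ls (M + 1 + g') := by
      rw [hword, hword (M + 1 + g'), List.append_assoc, List.replicate_append_replicate]
      congr 2
      omega
    have h1 := hσ.run [] (blockWord ls (M + 1 + g)) (by simpa using hle _ (by omega)) (τ g)
    have h2 := hσ.run (blockWord ls (M + 1 + g)) (List.replicate (g' - g : ℕ) Letter.b)
      (by rw [happ]; exact hle _ (by omega)) (τ g)
    rw [hσ.start] at h1
    rw [happ] at h2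
    refine hM ls hlen hnodup hlong _ (hmem g g.2) _ (by omega) _ _ h1 (hτ g) h2 ?_
    rw [heq]
    exact hτ g'
  obtain ⟨g, g', hne, heq⟩ := Fintype.exists_ne_map_eq_of_card_lt τ (by simpa using hfn)
  rcases lt_or_gt_of_ne hne with h | h
  · exact key _ _ h heq
  · exact key _ _ h heq.symm

theorem BigO_one_subset_BigO_id : BigO (fun _ => 1) ⊆ BigO (fun n => n) := by
  intro f hf
  refine Asymptotics.IsBigO.trans hf (Asymptotics.IsBigO.of_bound 1 ?_)
  filter_upwards [Filter.eventually_ge_atTop 1] with n hn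
  simpa using hn

theorem ExplCFL_mono (A : Type) {C D : Set (ℕ → ℕ)} (h : C ⊆ D) : ExplCFL A C ⊆ ExplCFL A D := by
  rintro L ⟨f, hf, hC, hL⟩
  exact ⟨f, hf, h hC, hL⟩

theorem Lblock_mem_ExplCFL_linear : Lblock ∈ ExplCFL Letter (BigO fun n => n) :=
  ⟨id, Computable.id, Asymptotics.isBigO_refl _ _, BlockState, BlockSym, inferInstance,
    inferInstance, blockPDA, blockPDA_language, fun n => ⟨_, blockPDA_isWinning n⟩⟩

theorem mainTheorem4 :
    -- constant explorability is included in linear explorability, over every finite alphabet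
    (∀ (A : Type) [Finite A], ExplCFL A (BigO fun _ => 1) ⊆ ExplCFL A (BigO fun n => n)) ∧
    -- the inclusion is strict, as is witnessed by `Lblock`
    ExplCFL Letter (BigO fun _ => 1) ⊂ ExplCFL Letter (BigO fun n => n) ∧
    Lblock ∈ ExplCFL Letter (BigO fun n => n) ∧
    Lblock ∉ ExplCFL Letter (BigO fun _ => 1) ∧
    -- one token per block: with `n` tokens for words of length at most `n`, Determiner wins so that
    -- token `i` accepts exactly when the number of `b`s is the length of block `i`
    (∃ (Q G : Type) (_ : Finite Q) (_ : Finite G) (P : PDA Q Letter G), P.language = Lblock ∧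
      ∀ n : ℕ, ∃ σ : PDA.Strategy Q Letter G n, P.IsWinning n σ ∧
        ∀ w : List Letter, w.length ≤ n → ∀ i : Fin n,
          ((σ w i).1 ∈ P.F ↔
            ∃ (ls : List ℕ) (m : ℕ), w = blockWord ls m ∧ ls[(i : ℕ)]? = some m)) := by
  refine ⟨fun A _ => ExplCFL_mono A BigO_one_subset_BigO_id, ?_, Lblock_mem_ExplCFL_linear,
    Lblock_notMem_ExplCFL_const, BlockState, BlockSym, inferInstance, inferInstance, blockPDA,
    blockPDA_language, fun n => ⟨_, blockPDA_isWinning n, fun w _ i =>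
      blockTraj_init_accept_iff i w⟩⟩
  exact ⟨ExplCFL_mono Letter BigO_one_subset_BigO_id, fun h =>
    Lblock_notMem_ExplCFL_const (h Lblock_mem_ExplCFL_linear)⟩
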